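/- Let $R$ be a unital ring. For $a,b\in R$ write $a\sim_0 b$ if $a=b$, write $a\sim_1 b$ if there are $c,d\in R$ with $a=cd$ and $b=dc$, and inductively $a\sim_{n+1}b$ if there is $c\in R$ with $a\sim_1 c$ and $c\sim_n b$. A subset $S\subseteq R$ is commutatively closed if $ab\in S$ implies $ba\in S$ for all $a,b\in R$; let $\overline{\{a\}}$ be the smallest commutatively closed subset of $R$ containing $a$. For $x,y\in\overline{\{a\}}$ put $d(x,y)=\min\{n\ge 0 : y\sim_n x\}$, and define the diameter of $R$ as $$\operatorname{diam}(R)=\sup_{a\in R}\ \sup\{d(x,y) : x,y\in\overline{\{a\}}\}\in\mathbb N\cup\{\infty\}.$$ Theorem. Let $R$ be a semisimple ring with Wedderburn–Artin decomposition $R\cong M_{n_1}(D_1)\times\dots\times M_{n_l}(D_l)$, where $D_1,\dots,D_l$ are division rings and $n_1,\dots,n_l\ge 1$. 1. If some $n_i\ge 2$, or if all the $D_i$ are commutative, then $\operatorname{diam}(R)=\max\{n_i-1 : 1\le i\le l\}$ (read as $0$ when $l=0$, that is, when $R$ is the zero ring). 2. In the remaining case, in which all $n_i=1$ and some $D_i$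 is not commutative, $\operatorname{diam}(R)=1$. -/

import Mathlib

/-- `CommStep a b` is the relation `a ∼₁ b`: there are `c, d` with `a = c d` and `b = d c`. -/
def CommStep {R : Type*} [Ring R] (a b : R) : Prop :=
  ∃ c d : R, a = c * d ∧ b = d * c

/-- `CommStepN n a b` is the relation `a ∼ₙ b`; `∼₀` is equality, and `a ∼ₙ₊₁ b` if and only if
`a ∼₁ c` and `c ∼ₙ b` for some `c`. -/
def CommStepN {R : Type*} [Ring R] : ℕ → R → R → Prop
  | 0, a, b => a = b
  | n + 1, a, b => ∃ c : R, CommStep a c ∧ CommStepN n c b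

/-- A subset `S` of a ring is commutatively closed if `a b ∈ S` implies `b a ∈ S`. -/
def IsCommutativelyClosed {R : Type*} [Ring R] (S : Set R) : Prop :=
  ∀ a b : R, a * b ∈ S → b * a ∈ S

/-- The commutative closure of `S`: the smallest commutatively closed subset containing `S`. -/
def commutativeClosure {R : Type*} [Ring R] (S : Set R) : Set R :=
  ⋂₀ {T : Set R | IsCommutativelyClosed T ∧ S ⊆ T}

/-- The distance `d(x, y)`: the least `n` with `y ∼ₙ x` (and `⊤` if there is none, which does not
happen for two elements of the commutative closure of one element). -/
noncomputable def commDist {R : Type*} [Ring R] (x y : R) : ℕ∞ :=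
  ⨅ (n : ℕ) (_ : CommStepN n y x), (n : ℕ∞)

/-- The diameter of the commutatively closed graph `C(a)`, whose vertex set is the commutative
closure of `{a}`. -/
noncomputable def commClassDiam {R : Type*} [Ring R] (a : R) : ℕ∞ :=
  ⨆ (x ∈ commutativeClosure ({a} : Set R)) (y ∈ commutativeClosure ({a} : Set R)), commDist x y

/-- The diameter of a subset `S` of a ring: the supremum of the diameters of `C(a)`, `a ∈ S`. -/
noncomputable def commDiam {R : Type*} [Ring R] (S : Set R) : ℕ∞ :=
  ⨆ a ∈ S, commClassDiam a

/-- The diameter of a ring `R`. -/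
noncomputable def ringCommDiam (R : Type*) [Ring R] : ℕ∞ :=
  commDiam (Set.univ : Set R)

/-! ### Chains of steps, shift equivalence, and the diameter in terms of chains. -/

section CommStep

variable {R S : Type*} [Ring R] [Ring S]

/-! Lower bound: a chain of length `k` from `a` to `0` forces `a ^ (k + 1) = 0`, so a nilpotent
Jordan block of size `n` is at distance at least `n - 1` from `0`.

Upper bound, for endomorphisms `x`, `y` of an `n`-dimensional space: a chain makes them shift
equivalent, so their invertible Fitting parts are isomorphic. Let `p` be the smaller nilpotency
index, say that of `x`. If `p = 0`, they are similar. Otherwise a block of size `p` is a direct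
summand of `x` and an invariant subspace of `y`; with the invertible part it forms a common part of
dimension at least 1. The remaining dimensions, at most `n - 1`, are exchanged one per step
(`commStepN_nilpotent_prodMap_restrict`), and similarity costs nothing in a nonempty chain. Chains
in a product are built componentwise. -/

theorem CommStep.refl (a : R) : CommStep a a := ⟨a, 1, by simp, by simp⟩

theorem CommStep.symm {a b : R} : CommStep a b → CommStep b a
  | ⟨c, d, h, h'⟩ => ⟨d, c, h', h⟩

theorem CommStepN.trans {m n : ℕ} {a b c : R} (h : CommStepN m a b) (h' : CommStepN n b c) :
    CommStepN (m + n) a c := by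
  induction m generalizing a with
  | zero => cases h; simpa using h'
  | succ m ih =>
    obtain ⟨d, h1, h2⟩ := h
    rw [Nat.succ_add]
    exact ⟨d, h1, ih h2⟩

theorem CommStep.stepN {a b : R} (h : CommStep a b) : CommStepN 1 a b := ⟨b, h, rfl⟩

theorem CommStepN.refl (n : ℕ) (a : R) : CommStepN n a a := by
  induction n with
  | zero => rfl
  | succ n ih => exact ⟨a, .refl a, ih⟩

theorem CommStepN.symm {n : ℕ} {a b : R} (h : CommStepN n a b) : CommStepN n b a := by
  induction n generalizing a with
  | zero => exact Eq.symm h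
  | succ n ih =>
    obtain ⟨c, h1, h2⟩ := h
    exact (ih h2).trans h1.symm.stepN

theorem CommStepN.mono {m n : ℕ} (hmn : m ≤ n) {a b : R} (h : CommStepN m a b) :
    CommStepN n a b := by
  obtain ⟨k, rfl⟩ := Nat.exists_eq_add_of_le hmn
  exact h.trans (.refl k b)

theorem CommStepN.map (f : R →+* S) {n : ℕ} {a b : R} (h : CommStepN n a b) :
    CommStepN n (f a) (f b) := by
  induction n generalizing a with
  | zero => exact congrArg f h
  | succ n ih =>
    obtain ⟨_, ⟨c, d, rfl, rfl⟩, h2⟩ := h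
    exact ⟨_, ⟨f c, f d, map_mul .., map_mul ..⟩, ih h2⟩

theorem CommStepN.map_iff (e : R ≃+* S) {n : ℕ} {a b : R} :
    CommStepN n (e a) (e b) ↔ CommStepN n a b :=
  ⟨fun h => by simpa using h.map e.symm.toRingHom, fun h => h.map e.toRingHom⟩

theorem CommStepN.pi {ι : Type*} {A : ι → Type*} [∀ i, Ring (A i)] {n : ℕ} {a b : ∀ i, A i}
    (h : ∀ i, CommStepN n (a i) (b i)) : CommStepN n a b := by
  induction n generalizing a with
  | zero => exact funext h
  | succ n ih =>
    choose z hz h2 using h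
    choose c d h3 h4 using hz
    exact ⟨z, ⟨c, d, funext h3, funext h4⟩, ih h2⟩

/-- Similarity can be absorbed into a nonempty chain. -/
theorem CommStepN.of_conj {n m : ℕ} (hn : n ≤ m) (hm : 1 ≤ m) {a b : R} (u : Rˣ)
    (h : CommStepN n a (u * b * ↑u⁻¹)) : CommStepN m a b := by
  obtain ⟨m, rfl⟩ := Nat.exists_eq_add_of_le' hm
  replace h := (h.mono hn).symm
  obtain ⟨z, ⟨c, d, h1, rfl⟩, h2⟩ := h
  refine CommStepN.symm ⟨_, ⟨↑u⁻¹ * c, d * u, ?_, ?_⟩, h2⟩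
  · rw [mul_assoc, ← mul_assoc c, ← h1]
    simp [mul_assoc]
  · simp [mul_assoc]

/-- The ends of a chain of length `n` are shift equivalent with lag `n`. -/
theorem CommStepN.exists_shiftEquiv {n : ℕ} {a b : R} (h : CommStepN n a b) :
    ∃ f g : R, f * a = b * f ∧ a * g = g * b ∧ g * f = a ^ n ∧ f * g = b ^ n := by
  induction n generalizing a with
  | zero => cases h; exact ⟨1, 1, by simp⟩
  | succ n ih =>
    obtain ⟨_, ⟨c, d, rfl, rfl⟩, h2⟩ := h
    obtain ⟨f, g, h3, h4, h5, h6⟩ := ih h2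
    refine ⟨f * d, c * g, ?_, ?_, ?_, ?_⟩
    · rw [← mul_assoc b, ← h3]; simp only [mul_assoc]
    · rw [mul_assoc c g b, ← h4]; simp only [mul_assoc]
    · rw [mul_assoc, ← mul_assoc g, h5, ← mul_assoc, pow_succ]
      have : SemiconjBy c (d * c) (c * d) := by simp [SemiconjBy, mul_assoc]
      rw [(this.pow_right n).eq, mul_assoc]
    · rw [mul_assoc, ← mul_assoc d, ← mul_assoc, ← mul_assoc, mul_assoc f d c, h3, mul_assoc, h6,
        pow_succ']

theorem CommStepN.pow_eq_zero {n : ℕ} {a : R} (h : CommStepN n a 0) : a ^ (n + 1) = 0 := by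
  obtain ⟨f, g, h1, -, h3, -⟩ := h.exists_shiftEquiv
  rw [pow_succ, ← h3, mul_assoc, h1]
  simp

theorem mem_commutativeClosure_singleton {a b : R} :
    b ∈ commutativeClosure ({a} : Set R) ↔ ∃ n, CommStepN n a b := by
  constructor
  · intro h
    refine h {b | ∃ n, CommStepN n a b} ⟨?_, by simpa using ⟨0, rfl⟩⟩
    rintro x y ⟨n, hn⟩
    exact ⟨n + 1, hn.trans (CommStep.stepN ⟨x, y, rfl, rfl⟩)⟩
  · rintro ⟨n, h⟩ T ⟨hT, haT⟩
    have ha : a ∈ T := haT rfl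
    clear haT
    induction n generalizing a with
    | zero => cases h; exact ha
    | succ n ih =>
      obtain ⟨_, ⟨c, d, rfl, rfl⟩, h2⟩ := h
      exact ih h2 (hT _ _ ha)

theorem commDist_le_iff {x y : R} {m : ℕ} : commDist x y ≤ m ↔ CommStepN m y x := by
  constructor
  · intro h
    by_contra hm
    have h2 : ((m + 1 : ℕ) : ℕ∞) ≤ commDist x y := by
      refine le_iInf₂ fun n hn => ?_
      by_contra hlt
      rw [Nat.cast_le, not_le] at hlt
      exact hm (hn.mono (Nat.lt_succ_iff.mp hlt))
    have := h2.trans h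
    rw [Nat.cast_le] at this
    omega
  · exact fun h => iInf₂_le m h

theorem ringCommDiam_le_iff {m : ℕ} :
    ringCommDiam R ≤ m ↔ ∀ n, ∀ a b : R, CommStepN n a b → CommStepN m a b := by
  simp only [ringCommDiam, commDiam, commClassDiam, iSup_le_iff, commDist_le_iff,
    mem_commutativeClosure_singleton]
  constructor
  · intro h n a b hab
    exact h b trivial b ⟨0, rfl⟩ a ⟨n, hab.symm⟩
  · rintro h a - x ⟨n, hx⟩ y ⟨k, hy⟩
    exact h (k + n) y x (hy.symm.trans hx)

theorem le_ringCommDiam {m n : ℕ} {a b : R} (hab : CommStepN n a b)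
    (h : ∀ k, CommStepN k a b → m ≤ k) : (m : ℕ∞) ≤ ringCommDiam R := by
  by_contra hlt
  rw [not_le] at hlt
  obtain ⟨k, hk⟩ := ENat.ne_top_iff_exists.mp (ne_top_of_lt hlt)
  rw [← hk, Nat.cast_lt] at hlt
  exact absurd (h k (ringCommDiam_le_iff.mp hk.symm.le n a b hab)) (by omega)

end CommStep

/-! ### Trading a nilpotent summand for the rest of `y`, one dimension per step. -/

section Nilpotent

variable {K : Type*} [DivisionRing K]

open Module

/-- A factorization `x = g f`, `y = f g` through another module gives a step between the
transported endomorphisms. -/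
theorem CommStep.of_factor {W A B : Type*} [AddCommGroup W] [Module K W] [AddCommGroup A]
    [Module K A] [AddCommGroup B] [Module K B] (e : W ≃ₗ[K] A) (e' : W ≃ₗ[K] B)
    (f : A →ₗ[K] B) (g : B →ₗ[K] A) :
    CommStep (e.symm.conjRingEquiv (g ∘ₗ f)) (e'.symm.conjRingEquiv (f ∘ₗ g)) := by
  refine ⟨e.symm.toLinearMap ∘ₗ g ∘ₗ e'.toLinearMap, e'.symm.toLinearMap ∘ₗ f ∘ₗ e.toLinearMap,
    ?_, ?_⟩ <;> ext w <;> simp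

theorem exists_hyperplane_range_le {V : Type*} [AddCommGroup V] [Module K V]
    [FiniteDimensional K V] [Nontrivial V] {x : End K V} (hx : IsNilpotent x) :
    ∃ H : Submodule K V, LinearMap.range x ≤ H ∧ finrank K H + 1 = finrank K V := by
  have hlt : LinearMap.range x < ⊤ := by
    refine lt_top_iff_ne_top.mpr fun h => ?_
    have hu : IsUnit x := by
      rw [Module.End.isUnit_iff]
      exact ⟨LinearMap.injective_iff_surjective.mpr (LinearMap.range_eq_top.mp h),
        LinearMap.range_eq_top.mp h⟩
    exact hx.not_isUnit hu
  obtain ⟨φ, hφ, hle⟩ := Submodule.exists_le_ker_of_lt_top _ hlt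
  refine ⟨LinearMap.ker φ, hle, ?_⟩
  rw [← LinearMap.finrank_range_add_finrank_ker φ,
    LinearMap.range_eq_top.mpr (LinearMap.surjective hφ), finrank_top, finrank_self, add_comm]

/-- Adjoin to `P` the last iterate `y ^ j w₀` lying outside `P`, for any `w₀ ∉ P`. -/
theorem exists_covering_submodule {W : Type*} [AddCommGroup W] [Module K W]
    [FiniteDimensional K W] {y : End K W} {N : ℕ} {P : Submodule K W}
    (hy : ∀ w ∈ P, y w ∈ P) (hN : LinearMap.range (y ^ N) ≤ P) (hP : P ≠ ⊤) :
    ∃ P' : Submodule K W, P ≤ P' ∧ (∀ w ∈ P', y w ∈ P) ∧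
      finrank K P' = finrank K P + 1 := by
  classical
  obtain ⟨w₀, hw₀⟩ : ∃ w, w ∉ P := by
    by_contra! h
    exact hP (eq_top_iff.mpr fun w _ => h w)
  have hex : ∃ j, (y ^ j) w₀ ∈ P := ⟨N, hN ⟨w₀, rfl⟩⟩
  obtain ⟨j, hj⟩ : ∃ j, Nat.find hex = j + 1 := by
    refine Nat.exists_eq_succ_of_ne_zero fun h => hw₀ ?_
    simpa [h] using Nat.find_spec hex
  have hw : (y ^ j) w₀ ∉ P := Nat.find_min hex (by omega)
  have hyw : y ((y ^ j) w₀) ∈ P := by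
    have := Nat.find_spec hex
    rwa [hj, pow_succ', Module.End.mul_apply] at this
  generalize (y ^ j) w₀ = w at hw hyw
  refine ⟨P ⊔ K ∙ w, le_sup_left, fun u hu => ?_, ?_⟩
  · obtain ⟨p, hp, z, hz, rfl⟩ := Submodule.mem_sup.mp hu
    obtain ⟨c, rfl⟩ := Submodule.mem_span_singleton.mp hz
    rw [map_add, map_smul]
    exact P.add_mem (hy p hp) (P.smul_mem c hyw)
  · have h1 := Submodule.finrank_sup_add_finrank_inf_eq P (K ∙ w)
    have h2 : P ⊓ K ∙ w = ⊥ := by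
      rw [← disjoint_iff, Submodule.disjoint_span_singleton' (by rintro rfl; exact hw P.zero_mem)]
      exact hw
    rw [h2, finrank_bot, finrank_span_singleton (by rintro rfl; exact hw P.zero_mem)] at h1
    simpa using h1

/-- If `y` is nilpotent modulo the invariant submodule `P` of codimension `s`, then the sum of
`y` on `P` and any nilpotent endomorphism of an `s`-dimensional space is reached from `y`, up to
similarity, in `s` steps. -/
theorem commStepN_nilpotent_prodMap_restrict {W : Type*} [AddCommGroup W] [Module K W]
    [FiniteDimensional K W] (y : End K W) (N s : ℕ) {V : Type*} [AddCommGroup V] [Module K V]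
    [FiniteDimensional K V] (x : End K V) (hx : IsNilpotent x) (hs : finrank K V = s)
    (P : Submodule K W) (hP : ∀ w ∈ P, y w ∈ P) (hN : LinearMap.range (y ^ N) ≤ P)
    (e : W ≃ₗ[K] V × P) :
    ∃ u : (End K W)ˣ, CommStepN s (e.symm.conjRingEquiv (x.prodMap (y.restrict hP))) (u * y * ↑u⁻¹) := by
  induction s generalizing V P with
  | zero =>
    have : Subsingleton V := finrank_zero_iff.mp hs
    have hfin := e.finrank_eq
    rw [finrank_prod, hs, zero_add] at hfin
    have : Unique V := ⟨⟨0⟩, fun v => Subsingleton.elim v 0⟩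
    -- With `V = 0` only `y` itself is left, transported by an automorphism of `W`.
    obtain rfl : P = ⊤ := Submodule.eq_top_of_finrank_eq hfin.symm
    let e' : W ≃ₗ[K] W := e.trans (LinearEquiv.uniqueProd.trans Submodule.topEquiv)
    refine ⟨⟨e'.symm, e', by ext; simp, by ext; simp⟩, ?_⟩
    change _ = e'.symm.toLinearMap * y * e'.toLinearMap
    ext w
    apply e'.injective
    simp [e']
  | succ s ih =>
    have : Nontrivial V := nontrivial_of_finrank_pos (R := K) (by omega)
    obtain ⟨H, hH, hHs⟩ := exists_hyperplane_range_le hx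
    have hfin := e.finrank_eq
    rw [finrank_prod, hs] at hfin
    obtain ⟨P', hPP', hyP', hP's⟩ := exists_covering_submodule hP hN (by
      rintro rfl
      rw [finrank_top] at hfin
      omega)
    have hxH : ∀ v ∈ H, x v ∈ H := fun v _ => hH ⟨v, rfl⟩
    have hP' : ∀ w ∈ P', y w ∈ P' := fun w hw => hPP' (hyP' w hw)
    have hx' : IsNilpotent (x.restrict hxH) := by
      obtain ⟨k, hk⟩ := hx
      refine ⟨k, ?_⟩
      rw [Module.End.pow_restrict]
      ext v
      simp [hk, LinearMap.restrict_apply]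
    obtain ⟨e'⟩ : Nonempty (W ≃ₗ[K] H × P') :=
      FiniteDimensional.nonempty_linearEquiv_of_finrank_eq (by rw [finrank_prod]; omega)
    obtain ⟨u, hu⟩ := ih (x.restrict hxH) hx' (by omega) P' hP' (hN.trans hPP') e'
    refine ⟨u, _, ?_, hu⟩
    -- Factor through `V × P → H × P' → V × P`: `x` and inclusion one way, inclusion and `y` back.
    -- The other composite is `x` on `H` plus `y` on `P'`.
    convert CommStep.of_factor e e'
      ((x.codRestrict H fun v => hH ⟨v, rfl⟩).prodMap (Submodule.inclusion hPP'))
      (H.subtype.prodMap ((y.domRestrict P').codRestrict P fun w => hyP' w w.2)) using 2 <;>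
      rfl

end Nilpotent

/-! ### Common invariant parts and nilpotent Jordan blocks. -/

section Fitting

variable {K : Type*} [DivisionRing K]

open Module

/-- Steps between `x` and `y` sharing, up to isomorphism, a common part `q`: it is an invariant
summand of `x` with nilpotent complement, and an invariant subspace of `y` modulo which `y` is
nilpotent. -/
theorem commStepN_of_common_part {W Q : Type*} [AddCommGroup W] [Module K W]
    [FiniteDimensional K W] [AddCommGroup Q] [Module K Q] [FiniteDimensional K Q]
    {x y : End K W} {q : End K Q} {i j : Q →ₗ[K] W} {r : W →ₗ[K] Q} {p N : ℕ}
    (hi : ∀ c, i (q c) = x (i c)) (hr : ∀ w, r (x w) = q (r w))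
    (hri : ∀ c, r (i c) = 0 → c = 0) (hx : ∀ w, r w = 0 → (x ^ p) w = 0)
    (hj : ∀ c, j (q c) = y (j c)) (hj' : Function.Injective j)
    (hy : LinearMap.range (y ^ N) ≤ LinearMap.range j) :
    ∃ u : (End K W)ˣ, CommStepN (finrank K W - finrank K Q) x (u * y * ↑u⁻¹) := by
  -- As `r ∘ i` is bijective, `W` is the direct sum of `ker r` and the image of `i`.
  have hinj : Function.Injective (r ∘ₗ i) := (injective_iff_map_eq_zero _).mpr hri
  have hsurj : Function.Surjective (r ∘ₗ i) := LinearMap.injective_iff_surjective.mp hinj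
  have hrank := LinearMap.finrank_range_add_finrank_ker r
  rw [LinearMap.range_eq_top.mpr (Function.Surjective.of_comp (g := i) hsurj), finrank_top] at hrank
  let t := LinearEquiv.ofInjective j hj'
  have ht (c) : (t c : W) = j c := LinearEquiv.ofInjective_apply ..
  let f : LinearMap.ker r × LinearMap.range j →ₗ[K] W :=
    (LinearMap.ker r).subtype.coprod (i ∘ₗ t.symm.toLinearMap)
  have hf : Function.Injective f := by
    rw [injective_iff_map_eq_zero]
    rintro ⟨v, z⟩ h
    obtain ⟨c, rfl⟩ := t.surjective z
    have h0 : (v : W) + i c = 0 := by simpa [f] using h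
    have hc : c = 0 := hri c <| by
      have := congrArg r h0
      rwa [map_add, LinearMap.mem_ker.mp v.2, zero_add, map_zero] at this
    subst hc
    ext
    · simpa using h0
    · simp
  have hdim : finrank K (LinearMap.ker r × LinearMap.range j) = finrank K W := by
    rw [finrank_prod, LinearMap.finrank_range_of_inj hj', ← hrank, add_comm]
  let e := LinearEquiv.ofInjectiveOfFinrankEq f hf hdim
  have hxr : ∀ w ∈ LinearMap.ker r, x w ∈ LinearMap.ker r := fun w hw => by
    rw [LinearMap.mem_ker, hr, LinearMap.mem_ker.mp hw, map_zero]
  have hyj : ∀ w ∈ LinearMap.range j, y w ∈ LinearMap.range j := by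
    rintro _ ⟨c, rfl⟩
    exact ⟨q c, hj c⟩
  have hnil : IsNilpotent (x.restrict hxr) := by
    refine ⟨p, ?_⟩
    rw [Module.End.pow_restrict]
    ext v
    exact hx v v.2
  obtain ⟨u, hu⟩ := commStepN_nilpotent_prodMap_restrict y N (finrank K W - finrank K Q)
    (x.restrict hxr) hnil (by omega) _ hyj hy e.symm
  refine ⟨u, ?_⟩
  have he (a b) : e (a, b) = (a : W) + i (t.symm b) := by
    change f (a, b) = _
    simp [f]
  have hq (c : Q) : y.restrict hyj (t c) = t (q c) := by
    apply Subtype.ext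
    rw [LinearMap.coe_restrict_apply, ht, ht, hj]
  convert hu
  ext w
  obtain ⟨⟨v, z⟩, rfl⟩ := e.surjective w
  obtain ⟨c, rfl⟩ := t.surjective z
  change _ = e ((x.restrict hxr).prodMap (y.restrict hyj) (e.symm (e (v, t c))))
  rw [LinearEquiv.symm_apply_apply, LinearMap.prodMap_apply, hq, he, he]
  simp [hi]

/-- The nilpotent shift on `K ^ p`. -/
def shiftEnd (K : Type*) [DivisionRing K] (p : ℕ) : End K (Fin p → K) where
  toFun c i := if h : i.1 + 1 < p then c ⟨i + 1, h⟩ else 0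
  map_add' c d := by ext i; dsimp; split_ifs <;> simp
  map_smul' a c := by ext i; dsimp; split_ifs <;> simp

theorem shiftEnd_pow_apply (p k : ℕ) (c : Fin p → K) (i : Fin p) :
    (shiftEnd K p ^ k) c i = if h : i.1 + k < p then c ⟨i + k, h⟩ else 0 := by
  induction k generalizing i with
  | zero => simp
  | succ k ih =>
    rw [pow_succ', Module.End.mul_apply]
    simp only [shiftEnd, LinearMap.coe_mk, AddHom.coe_mk] at ih ⊢
    split_ifs with h1 h2 h2
    · rw [ih, dif_pos (by simp; omega)]
      congr 2
      simp; omega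
    · rw [ih, dif_neg (by simp; omega)]
    · omega
    · rfl

theorem shiftEnd_pow_self (p : ℕ) : shiftEnd K p ^ p = 0 := by
  refine LinearMap.ext fun c => funext fun i => ?_
  rw [shiftEnd_pow_apply, dif_neg (by omega)]
  rfl

theorem shiftEnd_pow_ne_zero (r : ℕ) : shiftEnd K (r + 1) ^ r ≠ 0 := fun h => by
  have := congrFun (LinearMap.congr_fun h (1 : Fin (r + 1) → K)) 0
  rw [shiftEnd_pow_apply] at this
  simp at this

/-- The kernel of the shift is the line of the first basis vector, so the last nonzero shift of a
vector killed by `j` is a multiple of that vector. -/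
theorem injective_of_comp_shiftEnd {r : ℕ} {X : Type*} [AddCommGroup X] [Module K X]
    {y : End K X} {j : (Fin (r + 1) → K) →ₗ[K] X} (hj : ∀ c, j (shiftEnd K (r + 1) c) = y (j c))
    (h : j (Pi.single 0 1) ≠ 0) : Function.Injective j := by
  rw [injective_iff_map_eq_zero]
  intro c hc
  by_contra hne
  classical
  have hex : ∃ k, (shiftEnd K (r + 1) ^ k) c = 0 := ⟨r + 1, by rw [shiftEnd_pow_self]; rfl⟩
  obtain ⟨k, hk⟩ : ∃ k, Nat.find hex = k + 1 := by
    refine Nat.exists_eq_succ_of_ne_zero fun h => hne ?_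
    simpa [h] using Nat.find_spec hex
  have h1 : (shiftEnd K (r + 1) ^ k) c ≠ 0 := Nat.find_min hex (by omega)
  have h2 : shiftEnd K (r + 1) ((shiftEnd K (r + 1) ^ k) c) = 0 := by
    have := Nat.find_spec hex
    rwa [hk, pow_succ', Module.End.mul_apply] at this
  have h3 : j ((shiftEnd K (r + 1) ^ k) c) = 0 := by
    clear h1 h2 hk
    induction k with
    | zero => simpa using hc
    | succ k ih => rw [pow_succ', Module.End.mul_apply, hj, ih, map_zero]
  generalize (shiftEnd K (r + 1) ^ k) c = d at h1 h2 h3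
  have hd : d = d 0 • Pi.single 0 1 := by
    ext i
    refine Fin.cases ?_ (fun i => ?_) i
    · simp
    · have : d i.succ = 0 := by simpa [shiftEnd, Fin.succ] using congrFun h2 i.castSucc
      simpa using this
  have hd0 : d 0 ≠ 0 := fun h0 => h1 (by rw [hd, h0, zero_smul])
  rw [hd, map_smul, smul_eq_zero] at h3
  exact h3.elim hd0 h

/-- The map from a nilpotent Jordan block determined by a vector killed by `y ^ (r + 1)`. -/
theorem exists_map_shiftEnd {W : Type*} [AddCommGroup W] [Module K W] {y : End K W} {r : ℕ}
    {w : W} (hw : (y ^ (r + 1)) w = 0) :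
    ∃ j : (Fin (r + 1) → K) →ₗ[K] W,
      (∀ c, j (shiftEnd K (r + 1) c) = y (j c)) ∧ j (Pi.single 0 1) = (y ^ r) w := by
  refine ⟨Fintype.linearCombination K fun i : Fin (r + 1) => (y ^ (r - i)) w, fun c => ?_, ?_⟩
  · rw [Fintype.linearCombination_apply, Fintype.linearCombination_apply, Fin.sum_univ_castSucc,
      map_sum, Fin.sum_univ_succ]
    have h0 : y (c 0 • (y ^ (r - (0 : Fin (r + 1)).1)) w) = 0 := by
      rw [map_smul, ← Module.End.mul_apply, ← pow_succ']
      simp [hw]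
    rw [h0, zero_add]
    have h1 : shiftEnd K (r + 1) c (Fin.last r) = 0 := by simp [shiftEnd]
    rw [h1, zero_smul, add_zero]
    refine Finset.sum_congr rfl fun i _ => ?_
    have h2 : shiftEnd K (r + 1) c i.castSucc = c i.succ := by simp [shiftEnd, Fin.succ]
    rw [h2, map_smul, ← Module.End.mul_apply, ← pow_succ', Fin.val_succ, Fin.val_castSucc]
    congr 3
    omega
  · simp

/-- The map to a nilpotent Jordan block determined by a functional killed by `x ^ p`. -/
theorem exists_comap_shiftEnd {W : Type*} [AddCommGroup W] [Module K W] {x : End K W} {p : ℕ}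
    {φ : W →ₗ[K] K} (hφ : ∀ w, φ ((x ^ p) w) = 0) :
    ∃ b : W →ₗ[K] (Fin p → K),
      (∀ w, b (x w) = shiftEnd K p (b w)) ∧ ∀ w i, b w i = φ ((x ^ (i : ℕ)) w) := by
  refine ⟨LinearMap.pi fun i => φ ∘ₗ (x ^ (i : ℕ)), fun w => ?_, fun w i => rfl⟩
  ext i
  simp only [shiftEnd, LinearMap.pi_apply, LinearMap.comp_apply, LinearMap.coe_mk, AddHom.coe_mk]
  rw [← Module.End.mul_apply, ← pow_succ]
  split_ifs with h
  · rfl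
  · rw [show i.1 + 1 = p by omega, hφ]

end Fitting

/-! ### Bounds for endomorphism and matrix rings. -/

section Diameter

variable {K : Type*} [DivisionRing K]

open Module

theorem exists_ker_pow_stable {W : Type*} [AddCommGroup W] [Module K W]
    [FiniteDimensional K W] (x : End K W) :
    ∃ p, (∀ k w, (x ^ (p + k)) w = 0 → (x ^ p) w = 0) ∧
      ∀ r < p, ∃ w, (x ^ (r + 1)) w = 0 ∧ (x ^ r) w ≠ 0 := by
  classical
  have hex : ∃ p, ∀ w, (x ^ (p + 1)) w = 0 → (x ^ p) w = 0 := by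
    obtain ⟨p, -, hp⟩ := Module.End.exists_ker_pow_eq_ker_pow_succ x
    exact ⟨p, fun w hw => hp.ge hw⟩
  refine ⟨Nat.find hex, fun k => ?_, fun r hr => by simpa using Nat.find_min hex hr⟩
  induction k with
  | zero => exact fun w hw => hw
  | succ k ih =>
    intro w hw
    refine Nat.find_spec hex w ?_
    rw [pow_succ, Module.End.mul_apply]
    refine ih (x w) ?_
    rwa [← Module.End.mul_apply, ← pow_succ]

/-- `p` is the nilpotency index of `x`, and `hpy` makes that of `y` at least `p`: the block of size
`p` need split off from `x` only. -/
theorem CommStepN.of_finrank_aux {W : Type*} [AddCommGroup W] [Module K W]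
    [FiniteDimensional K W] {x y : End K W} {m p : ℕ} (h : CommStepN m x y)
    (hp : ∀ k w, (x ^ (p + k)) w = 0 → (x ^ p) w = 0)
    (hpx : ∀ r < p, ∃ w, (x ^ (r + 1)) w = 0 ∧ (x ^ r) w ≠ 0)
    (hpy : ∀ r < p, ∃ w, (y ^ (r + 1)) w = 0 ∧ (y ^ r) w ≠ 0) :
    CommStepN (max (finrank K W - 1) 1) x y := by
  obtain ⟨f, g, hfg, -, hgf, hfg'⟩ := h.exists_shiftEquiv
  have hfx (k : ℕ) (w : W) : f ((x ^ k) w) = (y ^ k) (f w) :=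
    LinearMap.congr_fun ((show SemiconjBy f x y from hfg).pow_right k).eq w
  have hgf' (w : W) : g (f w) = (x ^ m) w := LinearMap.congr_fun hgf w
  have hfg'' (w : W) : f (g w) = (y ^ m) w := LinearMap.congr_fun hfg' w
  have hpow (k l : ℕ) (w : W) : (x ^ k) ((x ^ l) w) = (x ^ (l + k)) w := by
    rw [add_comm, pow_add]; rfl
  have hker : ∀ a ∈ LinearMap.range (x ^ p), ∀ k, (x ^ k) a = 0 → a = 0 := by
    rintro _ ⟨b, rfl⟩ k hk
    exact hp k b (by rwa [hpow] at hk)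
  rcases p with _ | r
  · obtain ⟨u, hu⟩ := commStepN_of_common_part (x := x) (y := y) (q := x) (i := .id) (r := .id)
      (j := f) (p := 0) (N := m) (fun _ => rfl) (fun _ => rfl) (fun _ h => h) (fun _ h => h)
      (LinearMap.congr_fun hfg) ((injective_iff_map_eq_zero _).mpr fun a ha =>
        hker a ⟨a, rfl⟩ m (by rw [← hgf', ha, map_zero]))
      (by rintro _ ⟨w, rfl⟩; exact ⟨g w, hfg'' w⟩)
    exact .of_conj (by omega) (le_max_right ..) u hu
  obtain ⟨v, hv, hv'⟩ := hpx r r.lt_succ_self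
  obtain ⟨w, hw, hw'⟩ := hpy r r.lt_succ_self
  obtain ⟨i, hi, hi'⟩ := exists_map_shiftEnd hv
  obtain ⟨j, hj, hj'⟩ := exists_map_shiftEnd hw
  set V₁ := LinearMap.range (x ^ (r + 1))
  -- `x` is injective on `V₁` but kills `x ^ r v ≠ 0`. The functional `φ` yields the projection onto
  -- the block through `v`.
  obtain ⟨φ, hφ, hle⟩ := Submodule.exists_le_ker_of_notMem (p := V₁) (v := (x ^ r) v)
    fun hmem => hv' (hker _ hmem 1 (by rwa [hpow]))
  obtain ⟨b, hb, hb'⟩ := exists_comap_shiftEnd (x := x) (p := r + 1) (φ := φ)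
    fun w => hle ⟨w, rfl⟩
  have hxV : ∀ a ∈ V₁, x a ∈ V₁ := by
    rintro _ ⟨a, rfl⟩
    exact ⟨x a, by rw [← Module.End.mul_apply, ← Module.End.mul_apply, ← pow_succ, ← pow_succ']⟩
  have hxk : ∀ a ∈ V₁, ∀ k, (x ^ k) a ∈ V₁ := by
    rintro _ ⟨a, rfl⟩ k
    exact ⟨(x ^ k) a, by rw [hpow, hpow, add_comm]⟩
  have hbV : ∀ a ∈ V₁, b a = 0 := fun a ha => funext fun k => (hb' a k).trans (hle (hxk a ha k))
  have hshift {z : End K W} {t : (Fin (r + 1) → K) →ₗ[K] W}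
      (ht : ∀ c, t (shiftEnd K (r + 1) c) = z (t c)) (c) : (z ^ (r + 1)) (t c) = 0 := by
    have h1 (k : ℕ) : (z ^ k) (t c) = t ((shiftEnd K (r + 1) ^ k) c) := by
      induction k with
      | zero => rfl
      | succ k ih => rw [pow_succ', pow_succ', Module.End.mul_apply, Module.End.mul_apply, ih, ht]
    rw [h1, shiftEnd_pow_self, LinearMap.zero_apply, map_zero]
  have hbi : Function.Injective (b ∘ₗ i) := injective_of_comp_shiftEnd
    (y := shiftEnd K (r + 1)) (fun c => by simp [hi, hb]) fun h0 => hφ <| by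
      have := congrFun h0 0
      rwa [LinearMap.comp_apply, hi', hb'] at this
  have hji : Function.Injective j := injective_of_comp_shiftEnd hj (by rwa [hj'])
  obtain ⟨u, hu⟩ := commStepN_of_common_part (x := x) (y := y)
    (q := (x.restrict hxV).prodMap (shiftEnd K (r + 1))) (i := V₁.subtype.coprod i)
    (r := ((x ^ (r + 1)).codRestrict V₁ fun w => ⟨w, rfl⟩).prod b)
    -- `g f = x ^ m` makes `f` injective on `V₁`, and `y ^ (r + 1 + m) = f x ^ (r + 1) g` has range
    -- in `f V₁`.
    (j := (f ∘ₗ V₁.subtype).coprod j) (p := r + 1) (N := r + 1 + m)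
    (fun c => by simp [hi])
    (fun w => Prod.ext (Subtype.ext (by
      change (x ^ (r + 1)) (x w) = x ((x ^ (r + 1)) w)
      rw [← Module.End.mul_apply, ← Module.End.mul_apply, ← pow_succ, ← pow_succ'])) (hb w))
    (fun ⟨a, c⟩ h0 => by
      obtain ⟨h1, h2⟩ := Prod.ext_iff.mp h0
      replace h1 : (x ^ (r + 1)) (a + i c) = 0 := congrArg Subtype.val h1
      replace h2 : b (a + i c) = 0 := h2
      rw [map_add, hshift hi, add_zero] at h1
      rw [map_add, hbV a a.2, zero_add] at h2
      exact Prod.ext (Subtype.ext (hker a a.2 _ h1)) (hbi (h2.trans (map_zero (b ∘ₗ i)).symm)))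
    (fun w h0 => congrArg Subtype.val (Prod.ext_iff.mp h0).1)
    (fun c => by
      have := hfx 1 c.1
      rw [pow_one, pow_one] at this
      simp [hj, this])
    ((injective_iff_map_eq_zero _).mpr fun ⟨a, c⟩ h0 => by
      replace h0 : f a + j c = 0 := h0
      have h1 := congrArg (y ^ (r + 1)) h0
      rw [map_add, hshift hj, add_zero, map_zero, ← hfx] at h1
      have h2 : (a : W) = 0 := by
        refine hker a a.2 (r + 1 + m) ?_
        rw [← hpow, ← hgf', h1, map_zero]
      rw [h2, map_zero, zero_add] at h0
      exact Prod.ext (Subtype.ext h2) (hji (h0.trans (map_zero j).symm)))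
    (by
      rintro _ ⟨z, rfl⟩
      refine ⟨(⟨(x ^ (r + 1)) (g z), ⟨_, rfl⟩⟩, 0), ?_⟩
      change f ((x ^ (r + 1)) (g z)) + j 0 = _
      rw [map_zero, add_zero, hfx, hfg'', pow_add _ (r + 1)]
      rfl)
  refine .of_conj ?_ (le_max_right ..) u hu
  rw [finrank_prod, finrank_fin_fun]
  omega

/-- Any two endomorphisms of an `n`-dimensional space that are joined by a chain are joined by a
chain of length `max (n - 1) 1`. -/
theorem CommStepN.of_finrank {W : Type*} [AddCommGroup W] [Module K W]
    [FiniteDimensional K W] {x y : End K W} {m : ℕ} (h : CommStepN m x y) :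
    CommStepN (max (finrank K W - 1) 1) x y := by
  obtain ⟨p, hp, hp'⟩ := exists_ker_pow_stable x
  obtain ⟨q, hq, hq'⟩ := exists_ker_pow_stable y
  rcases le_total p q with hpq | hpq
  · exact h.of_finrank_aux hp hp' fun r hr => hq' r (hr.trans_le hpq)
  · exact (h.symm.of_finrank_aux hq hq' fun r hr => hp' r (hr.trans_le hpq)).symm

theorem exists_commStepN_zero_of_isNilpotent {W : Type*} [AddCommGroup W] [Module K W]
    [FiniteDimensional K W] {x : End K W} (hx : IsNilpotent x) : ∃ n, CommStepN n x 0 := by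
  obtain ⟨p, hp⟩ := hx
  obtain ⟨u, hu⟩ := commStepN_of_common_part (x := x) (y := 0) (q := (0 : End K PUnit.{1}))
    (i := 0) (r := 0) (j := 0) (p := p) (N := 1) (by simp) (by simp)
    (fun _ _ => Subsingleton.elim _ _) (by simp [hp]) (by simp)
    (fun _ _ _ => Subsingleton.elim _ _) (by simp)
  exact ⟨_, by simpa using hu⟩

/-- Over a noncommutative `K`, matrices acting on row vectors form the opposite of the endomorphism
ring. -/
theorem CommStepN.op {R : Type*} [Ring R] {n : ℕ} {a b : R} (h : CommStepN n a b) :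
    CommStepN n (MulOpposite.op a) (MulOpposite.op b) := by
  induction n generalizing a with
  | zero => exact congrArg _ h
  | succ n ih =>
    obtain ⟨_, ⟨c, d, rfl, rfl⟩, h2⟩ := h
    exact ⟨_, ⟨.op d, .op c, rfl, rfl⟩, ih h2⟩

theorem CommStepN.unop {R : Type*} [Ring R] {n : ℕ} {a b : Rᵐᵒᵖ} (h : CommStepN n a b) :
    CommStepN n a.unop b.unop := by
  induction n generalizing a with
  | zero => exact congrArg _ h
  | succ n ih =>
    obtain ⟨_, ⟨c, d, rfl, rfl⟩, h2⟩ := h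
    exact ⟨_, ⟨d.unop, c.unop, rfl, rfl⟩, ih h2⟩

theorem CommStepN.matrix_bound {n m : ℕ} {a b : Matrix (Fin n) (Fin n) K}
    (h : CommStepN m a b) : CommStepN (max (n - 1) 1) a b := by
  let e := matrixRingEquivEndVecMulOpposite (ι := Fin n) (A := K)
  have h1 := (((CommStepN.map_iff e).mpr h).unop.of_finrank).op
  rw [finrank_fin_fun] at h1
  exact (CommStepN.map_iff e).mp h1

theorem Matrix.exists_commStepN_zero (K : Type*) [DivisionRing K] {n : ℕ} (hn : 1 ≤ n) :
    ∃ a : Matrix (Fin n) (Fin n) K, (∃ k, CommStepN k a 0) ∧ ∀ k, CommStepN k a 0 → n - 1 ≤ k := by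
  obtain ⟨r, rfl⟩ := Nat.exists_eq_add_of_le' hn
  let e := matrixRingEquivEndVecMulOpposite (ι := Fin (r + 1)) (A := K)
  obtain ⟨k, hk⟩ := exists_commStepN_zero_of_isNilpotent
    (x := shiftEnd K (r + 1)) ⟨r + 1, shiftEnd_pow_self _⟩
  refine ⟨e.symm (.op (shiftEnd K (r + 1))), ⟨k, ?_⟩, fun l hl => ?_⟩
  · rw [← CommStepN.map_iff e]
    simpa using hk.op
  · rw [← CommStepN.map_iff e] at hl
    have h1 : shiftEnd K (r + 1) ^ (l + 1) = 0 := by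
      simpa using CommStepN.pow_eq_zero (by simpa using hl.unop)
    by_contra hlt
    exact shiftEnd_pow_ne_zero r (pow_eq_zero_of_le (by omega) h1)

end Diameter

/-! ### Commutativity, products and the theorem. -/

theorem ringCommDiam_eq_zero_of_commute {R : Type*} [Ring R] (h : ∀ x y : R, x * y = y * x) :
    ringCommDiam R = 0 := by
  have : ringCommDiam R ≤ (0 : ℕ) := by
    rw [ringCommDiam_le_iff]
    intro n a b hab
    induction n generalizing a with
    | zero => exact hab
    | succ n ih =>
      obtain ⟨_, ⟨c, d, rfl, rfl⟩, h2⟩ := hab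
      rw [h c d]
      exact ih _ h2
  simpa using this

theorem one_le_ringCommDiam {R : Type*} [Ring R] {x y : R} (h : x * y ≠ y * x) :
    1 ≤ ringCommDiam R := by
  have : ((1 : ℕ) : ℕ∞) ≤ ringCommDiam R := by
    refine le_ringCommDiam (CommStep.stepN ⟨x, y, rfl, rfl⟩) fun k hk => ?_
    rw [Nat.one_le_iff_ne_zero]
    rintro rfl
    exact h hk
  simpa using this

theorem mainTheorem1 {R : Type*} [Ring R] [IsSemisimpleRing R]
    (l : ℕ) (n : Fin l → ℕ) (hn : ∀ i, 1 ≤ n i)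
    (D : Fin l → Type*) [∀ i, DivisionRing (D i)]
    (e : R ≃+* (∀ i : Fin l, Matrix (Fin (n i)) (Fin (n i)) (D i))) :
    (((∃ i, 2 ≤ n i) ∨ (∀ i, ∀ x y : D i, x * y = y * x)) →
      ringCommDiam R = ((Finset.univ.sup (fun i => n i - 1) : ℕ) : ℕ∞)) ∧
    (((∀ i, n i = 1) ∧ (∃ i, ∃ x y : D i, x * y ≠ y * x)) →
      ringCommDiam R = 1) := by
  have upper (m : ℕ) (hm : 1 ≤ m) (hnm : ∀ i, n i - 1 ≤ m) : ringCommDiam R ≤ m := by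
    rw [ringCommDiam_le_iff]
    intro k a b hab
    refine (CommStepN.map_iff e).mp (CommStepN.pi fun i => ?_)
    exact (((CommStepN.map_iff e).mpr hab).map (Pi.evalRingHom _ i)).matrix_bound.mono
      (max_le (hnm i) hm)
  constructor
  · intro h
    by_cases h2 : ∃ i, 2 ≤ n i
    · obtain ⟨i₀, hi₀⟩ := h2
      have hle (i) : n i - 1 ≤ Finset.univ.sup (fun i => n i - 1) :=
        Finset.le_sup (f := fun i => n i - 1) (Finset.mem_univ i)
      -- The supremum is at least 1, which also covers noncommutative blocks of size 1.
      refine le_antisymm (upper _ ((by omega : 1 ≤ n i₀ - 1).trans (hle i₀)) hle) ?_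
      obtain ⟨i, -, hi⟩ := Finset.exists_mem_eq_sup Finset.univ ⟨i₀, Finset.mem_univ _⟩
        (fun i => n i - 1)
      rw [hi]
      obtain ⟨a, ⟨k, hk⟩, ha⟩ := Matrix.exists_commStepN_zero (D i) (hn i)
      have hstep : CommStepN k (Pi.single i a : ∀ i, Matrix (Fin (n i)) (Fin (n i)) (D i)) 0 := by
        refine CommStepN.pi fun t => ?_
        by_cases ht : t = i
        · subst ht
          simpa using hk
        · simpa [ht] using CommStepN.refl k _
      refine le_ringCommDiam (a := e.symm (Pi.single i a)) (b := 0) (n := k) ?_ fun s hs => ha s ?_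
      · rw [← CommStepN.map_iff e]
        simpa using hstep
      · simpa using ((CommStepN.map_iff e).mpr hs).map (Pi.evalRingHom _ i)
    · have hD := h.resolve_left h2
      push Not at h2
      have h1 (i) : n i = 1 := le_antisymm (Nat.lt_succ_iff.mp (h2 i)) (hn i)
      have hsup : Finset.univ.sup (fun i => n i - 1) = 0 := by simp [h1]
      rw [hsup, ringCommDiam_eq_zero_of_commute, Nat.cast_zero]
      intro x y
      apply e.injective
      rw [map_mul, map_mul]
      ext i s t
      have : Subsingleton (Fin (n i)) := by rw [h1 i]; infer_instance
      obtain rfl := Subsingleton.elim s t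
      simp only [Pi.mul_apply, Matrix.mul_apply]
      exact Finset.sum_congr rfl fun k _ => by
        obtain rfl := Subsingleton.elim s k
        exact hD i _ _
  · rintro ⟨h1, i, x, y, hxy⟩
    refine le_antisymm (by simpa using upper 1 le_rfl (by simp [h1])) ?_
    refine one_le_ringCommDiam (x := e.symm (Pi.single i (Matrix.scalar _ x)))
      (y := e.symm (Pi.single i (Matrix.scalar _ y))) fun h => hxy ?_
    rw [← map_mul, ← map_mul, e.symm.injective.eq_iff, ← Pi.single_mul, ← Pi.single_mul,
      (Pi.single_injective i).eq_iff, ← map_mul, ← map_mul] at h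
    have := congrFun (congrFun h ⟨0, hn i⟩) ⟨0, hn i⟩
    simpa using this
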